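/- Write $\operatorname{lg} x=\max\{1,\log_2 x\}$. A network is a connected undirected graph with $n$ nodes and diameter $D$, working in synchronous rounds. In the \emph{beep model}, in each round every node either beeps or is silent, and a silent node learns whether at least one of its neighbours beeps (a beeping node learns nothing). In the \emph{radio model with collision detection}, in each round every node either listens or transmits a packet of $k$ bits; a listening node receives the packet if exactly one of its neighbours transmits, detects a collision if two or more do, and perceives silence otherwise. All nodes run the same program, each with its own independent random bits, which include a uniformly random identifier of $\Theta(\log n)$ bits. The only knowledge that the nodes have about the network is estimates of $n$ and $D$ that are correct up to a constant factor $\kappa$. At round $0$ an arbitrary nonempty set of nodes is awake; the other nodes only listen, without running the program, until they hear a beep, or receive a packet or detect a collision. \textbf{Theorem.} For all constants $c$ and $\kappa\ge 1$ there is a constant $C$ such that, in the beep model, there is a randomized distributed algorithm with the following property. On every connected network with $n$ nodes and diameter $D$, for every nonempty set of initially awake nodes and all estimates of $n$ and $D$ that are correct up to the factor $\kappa$, with probability at least $1-n^{-c}$ there is a single node (the leader), whose identifier is shared by no other node, such that no node ever outputs an identifier other than the leader's, and all nodes have output the leader's identifier by round $$C\cdot\bigl(D+\operatorname{lg} n\cdot\operatorname{lg}\operatorname{lg}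 n\bigr)\cdot\min\Bigl\{\operatorname{lg}\operatorname{lg} n,\ \operatorname{lg}\frac nD\Bigr\}$$ (for $n=1$, where $D=0$, the minimum is read as $1$). The same holds, with the same $C$, in the radio model with collision detection, for packets of any number $k$ of bits (which may depend on the estimate of $n$). -/

import Mathlib

/-- A communication medium for synchronous rounds on a graph. In a round every node either listens
(`none`) or transmits a packet (`some p`); `observe G x v` is what `v` perceives when the choices of
all the nodes are given by `x`, and `wakes o` says whether the observation `o` wakes up a sleeping
node. -/
structure Medium where
  Packet : Type
  Obs : Type
  wakes : Obs → Bool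
  observe : {V : Type} → [Fintype V] → SimpleGraph V → (V → Option Packet) → V → Obs

open Classical in
/-- The beep model: a transmission is a content-free beep. A silent node learns whether at least
one of its neighbours beeps; a beeping node learns nothing. -/
noncomputable def beepMedium : Medium where
  Packet := Unit
  Obs := Bool
  wakes := id
  observe := fun G x v => decide (x v = none ∧ ∃ u, G.Adj v u ∧ x u ≠ none)

/-- What a node perceives in a radio network with collision detection. -/
inductive RadioObs (P : Type) where
  | silence : RadioObs P
  | packet (p : P) : RadioObs P
  | collision : RadioObs P

/-- Message receptions and detected collisions wake up a sleeping node, silence does not. -/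
def RadioObs.wakes {P : Type} : RadioObs P → Bool
  | .silence => false
  | .packet _ => true
  | .collision => true

open Classical in
/-- The radio network model with collision detection and packets of `k` bits: a listening node
receives the packet of its only transmitting neighbour if there is exactly one, detects a collision
if there are two or more, and perceives silence if there is none. A transmitting node learns
nothing. -/
noncomputable def radioMedium (k : ℕ) : Medium where
  Packet := Fin k → Bool
  Obs := RadioObs (Fin k → Bool)
  wakes := RadioObs.wakes
  observe := fun G x v =>
    if x v = none then
      match (G.neighborFinset v).toList.filterMap x with
      | [] => .silence
      | [p] => .packet p
      | _ => .collision
    else .silence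

/-- The private randomness of a node: an identifier of `b` random bits, and `r` further coins. -/
abbrev Seed (b r : ℕ) : Type := (Fin b → Bool) × (Fin r → Bool)

/-- The program that every node runs (nodes are anonymous apart from their private randomness).
`start` is the initial state of a node that wakes up spontaneously in round `0`, `wake` that of a
node woken up by an observation. In a round, a node in state `s` does `transmit s`, observes `o`
and moves to `next s o`. `output s` is the identifier that the node has output, if any. -/
structure Protocol (m : Medium) (b r : ℕ) where
  State : Type
  start : Seed b r → State
  wake : Seed b r → m.Obs → State
  transmit : State → Option m.Packet
  next : State → m.Obs → State
  output : State → Option (Fin b → Bool)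

namespace Protocol

variable {m : Medium} {b r : ℕ} {V : Type} [Fintype V]

open Classical in
/-- The states of the nodes after `t` rounds on the network `G`, when the nodes of `W` are those
awake at round `0` and `ω` is the randomness of the nodes. A sleeping node has state `none`; it
listens until it is woken up. -/
noncomputable def config (P : Protocol m b r) (G : SimpleGraph V) (W : Set V)
    (ω : V → Seed b r) : ℕ → V → Option P.State
  | 0, v => if v ∈ W then some (P.start (ω v)) else none
  | t + 1, v =>
    let o := m.observe G (fun u => (P.config G W ω t u).bind P.transmit) v
    match P.config G W ω t v with
    | some s => some (P.next s o)
    | none => if m.wakes o then some (P.wake (ω v) o) else none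

/-- The output of node `v` after `t` rounds. -/
noncomputable def outputAt (P : Protocol m b r) (G : SimpleGraph V) (W : Set V)
    (ω : V → Seed b r) (t : ℕ) (v : V) : Option (Fin b → Bool) :=
  (P.config G W ω t v).bind P.output

/-- In the execution with randomness `ω`, a leader is elected by time `T`: there is a node `l`, the
only one with its identifier, such that no node ever outputs anything but the identifier of `l`,
and every node has output it from time `T` on. -/
def ElectsLeaderBy (P : Protocol m b r) (G : SimpleGraph V) (W : Set V)
    (ω : V → Seed b r) (T : ℝ) : Prop :=
  ∃ l : V, (∀ v, (ω v).1 = (ω l).1 → v = l) ∧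
    (∀ (t : ℕ) (v : V) (i : Fin b → Bool), P.outputAt G W ω t v = some i → i = (ω l).1) ∧
    (∀ (t : ℕ) (v : V), T ≤ t → P.outputAt G W ω t v = some (ω l).1)

end Protocol

open Classical in
/-- The probability of an event under the uniform distribution on a finite sample space. -/
noncomputable def uniformProb {Ω : Type} [Fintype Ω] (E : Ω → Prop) : ℝ :=
  ((Finset.univ.filter E).card : ℝ) / (Fintype.card Ω : ℝ)

/-- A distributed algorithm: it knows the estimates `N` and `Δ` of the number of nodes and of the
diameter, and nothing else about the network. Identifiers have `Θ(log N)` bits. For the radio model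
the number of bits of a packet may depend on `N`, whence the family `m` of media. -/
structure DistributedAlgorithm (m : ℕ → Medium) where
  idFactor : ℕ
  idFactor_pos : 0 < idFactor
  coins : ℕ → ℕ → ℕ
  protocol : (N Δ : ℕ) → Protocol (m N) (idFactor * (Nat.log 2 N + 1)) (coins N Δ)

/-- The logarithm of asymptotic bounds, `max {1, log₂ x}`. -/
noncomputable def lg (x : ℝ) : ℝ := max 1 (Real.logb 2 x)

/-- `(D + log n log log n) · min {log log n, log (n / D)}`. -/
noncomputable def electionTime (n D : ℕ) : ℝ :=
  ((D : ℝ) + lg n * lg (lg n)) * min (lg (lg n)) (lg ((n : ℝ) / (D : ℝ)))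

/-- On every connected network, for every nonempty set `W` of nodes awake at round `0`, and for all
estimates of the number `n` of nodes and of the diameter `D` that are correct up to the factor `κ`,
the algorithm elects a leader by round `C · electionTime n D` with probability at least
`1 - 1 / n ^ c`. -/
def DistributedAlgorithm.SolvesLeaderElection {m : ℕ → Medium} (A : DistributedAlgorithm m)
    (c κ C : ℕ) : Prop :=
  ∀ (V : Type) [Fintype V] [DecidableEq V] (G : SimpleGraph V) (W : Set V) (N Δ : ℕ),
    G.Connected → W.Nonempty →
    Fintype.card V ≤ κ * N → N ≤ κ * Fintype.card V →
    G.diam ≤ κ * Δ → Δ ≤ κ * G.diam →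
    1 - 1 / (Fintype.card V : ℝ) ^ c ≤
      uniformProb (fun ω : V → Seed (A.idFactor * (Nat.log 2 N + 1)) (A.coins N Δ) =>
        (A.protocol N Δ).ElectsLeaderBy G W ω (C * electionTime (Fintype.card V) G.diam))

/-
Each node keeps a bit string that grows, bit by bit, into the largest identifier. A node extends
its string by the largest bit on offer as soon as its neighbours have caught up, so that different
regions of the network work on different positions at the same time. A wrong bit is repaired by
retraction: a node drops its last bit if a neighbour is at least two bits behind or has a
lexicographically larger string, where only the last two bits need to be compared. Strings of
neighbours thus differ in length by at most two, and by induction on the time, a node at distance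
`d` from the leader has its first `i` bits right, once and for all, after `3 i + 2 d` steps.

Since a step depends only on a window of a few bits of the neighbours' strings at positions known up
to a constant, a constant number of codes suffices to announce it. A slot has three rounds for each
code, and a node makes noise in the middle one of the three that belong to its own code; hearing
noise or not is all that the others need. So the election takes `O(D + log n)` rounds, and it
succeeds if the random identifiers are distinct.
-/

/-- A bit string, used as a node's estimate of the largest identifier. It is encoded with junk: the
values of `bit` from position `len` on are meaningless. -/
structure BitPrefix where
  len : ℕ
  bit : ℕ → Bool

namespace BitPrefix

/-- The empty bit string, the estimate with which every node begins. -/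
def empty : BitPrefix := ⟨0, fun _ => false⟩

/-- The bit string `s` and the infinite sequence `m` have the same first `i` bits. -/
def Agrees (s : BitPrefix) (m : ℕ → Bool) (i : ℕ) : Prop :=
  i ≤ s.len ∧ ∀ j < i, s.bit j = m j

/-- The condition for a node with estimate `s` to discard its last bit, when `N` is the set of the
estimates of its neighbours: one of them lags behind by at least two bits, or is lexicographically
larger because of one of the last two bits of `s`. -/
def MustRetract (s : BitPrefix) (N : Set BitPrefix) : Prop :=
  ∃ u ∈ N, u.len + 2 ≤ s.len ∨
    ∃ j < s.len, s.len ≤ j + 2 ∧ j < u.len ∧ s.bit j < u.bit j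

/-- The bits by which `s` may be extended: the next bit of the node's own identifier `a`, if `s` is
a prefix of it, and the bits at this position in the longer estimates of neighbours. -/
def offeredBits (a : ℕ → Bool) (s : BitPrefix) (N : Set BitPrefix) : Set Bool :=
  {x | (s.Agrees a s.len ∧ a s.len = x) ∨ ∃ u ∈ N, s.len < u.len ∧ u.bit s.len = x}

/-- The condition for a node to extend its estimate `s`: all the neighbours have caught up, their
estimates have the last bit of `s` in its place, and there is a bit on offer. -/
def MayExtend (a : ℕ → Bool) (s : BitPrefix) (N : Set BitPrefix) : Prop :=
  (∀ u ∈ N, s.len ≤ u.len ∧ ∀ j, j + 1 = s.len → u.bit j = s.bit j) ∧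
    (s.offeredBits a N).Nonempty

open Classical in
/-- One step of the synchronous process whose limit is the largest identifier: the new estimate of
a node with identifier `a` and estimate `s`, when `N` is the set of the estimates of its
neighbours. -/
noncomputable def advance (a : ℕ → Bool) (s : BitPrefix) (N : Set BitPrefix) : BitPrefix :=
  if s.MustRetract N then ⟨s.len - 1, s.bit⟩
  else if s.MayExtend a N then
    ⟨s.len + 1, Function.update s.bit s.len (sSup (s.offeredBits a N))⟩
  else s

section Advance

variable {a : ℕ → Bool} {s : BitPrefix} {N : Set BitPrefix}

theorem advance_of_mustRetract (h : s.MustRetract N) : s.advance a N = ⟨s.len - 1, s.bit⟩ :=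
  if_pos h

theorem advance_of_mayExtend (h : ¬ s.MustRetract N) (h' : s.MayExtend a N) :
    s.advance a N = ⟨s.len + 1, Function.update s.bit s.len (sSup (s.offeredBits a N))⟩ :=
  (if_neg h).trans (if_pos h')

theorem advance_of_not_mayExtend (h : ¬ s.MustRetract N) (h' : ¬ s.MayExtend a N) :
    s.advance a N = s :=
  (if_neg h).trans (if_neg h')

theorem len_advance_le_succ : (s.advance a N).len ≤ s.len + 1 := by
  unfold advance
  split_ifs <;> grind

theorem len_le_len_advance_succ : s.len ≤ (s.advance a N).len + 1 := by
  unfold advance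
  split_ifs <;> grind

theorem len_le_len_advance (h : ¬ s.MustRetract N) : s.len ≤ (s.advance a N).len := by
  rw [advance, if_neg h]
  split_ifs <;> grind

theorem advance_of_len_lt (h : s.len < (s.advance a N).len) :
    s.MayExtend a N ∧ (s.advance a N).bit s.len = sSup (s.offeredBits a N) := by
  by_cases hr : s.MustRetract N
  · rw [advance_of_mustRetract hr] at h
    dsimp only at h
    omega
  by_cases he : s.MayExtend a N
  · rw [advance_of_mayExtend hr he]
    exact ⟨he, Function.update_self ..⟩
  · rw [advance_of_not_mayExtend hr he] at h
    exact absurd h (lt_irrefl _)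

theorem bit_advance {j : ℕ} (hj : j < s.len) : (s.advance a N).bit j = s.bit j := by
  unfold advance
  split_ifs
  · rfl
  · exact Function.update_of_ne hj.ne ..
  · rfl

theorem agrees_advance_iff {m : ℕ → Bool} {i : ℕ} (hi : i ≤ s.len)
    (hi' : i ≤ (s.advance a N).len) : (s.advance a N).Agrees m i ↔ s.Agrees m i := by
  simp only [Agrees, hi, hi', true_and]
  exact forall₂_congr fun j hj => by rw [bit_advance (hj.trans_le hi)]

end Advance

theorem agrees_zero (s : BitPrefix) (m : ℕ → Bool) : s.Agrees m 0 :=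
  ⟨Nat.zero_le _, fun _ hj => absurd hj (Nat.not_lt_zero _)⟩

variable {s : BitPrefix} {m : ℕ → Bool} {i k : ℕ}

theorem Agrees.mono (h : s.Agrees m k) (hik : i ≤ k) : s.Agrees m i :=
  ⟨hik.trans h.1, fun j hj => h.2 j (hj.trans_le hik)⟩

theorem agrees_succ_iff :
    s.Agrees m (i + 1) ↔ s.Agrees m i ∧ i < s.len ∧ s.bit i = m i := by
  simp only [Agrees, Nat.forall_lt_succ_right]
  grind

end BitPrefix

open BitPrefix

section Evolution

variable {V : Type*}

/-- One synchronous step of all the nodes of the network `G` with identifiers `a` and estimates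
`X`. -/
noncomputable def advanceAll (G : SimpleGraph V) (a : V → ℕ → Bool) (X : V → BitPrefix) (v : V) :
    BitPrefix :=
  (X v).advance (a v) (X '' G.neighborSet v)

/-- The estimates of the nodes after a number of synchronous steps. -/
noncomputable def estimate (G : SimpleGraph V) (a : V → ℕ → Bool) : ℕ → V → BitPrefix
  | 0 => fun _ => empty
  | t + 1 => advanceAll G a (estimate G a t)

/-- The invariant of the synchronous process, for the lexicographically largest identifier `m`. -/
structure Coherent (G : SimpleGraph V) (m : ℕ → Bool) (X : V → BitPrefix) : Prop where
  len_le {u v} : G.Adj u v → (X u).len ≤ (X v).len + 2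
  bit_le {v i} : (X v).Agrees m i → i < (X v).len → (X v).bit i ≤ m i
  agrees_of_adj {v u i} : G.Adj v u → (X v).Agrees m i → i < (X v).len → (X u).Agrees m i

/-- A node that is about to extend a prefix of `m` is certain to be offered the next bit of `m`:
this is its own identifier, or a neighbour has got this bit already. -/
def IsInformed (G : SimpleGraph V) (a : V → ℕ → Bool) (m : ℕ → Bool) (X : V → BitPrefix)
    (v : V) : Prop :=
  a v = m ∨ ∃ u, G.Adj v u ∧ (X u).Agrees m ((X v).len + 1)

variable {G : SimpleGraph V} {a : V → ℕ → Bool} {m : ℕ → Bool} {X : V → BitPrefix} {u v : V}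

theorem len_advanceAll_le_of_adj (h : Coherent G m X) (huv : G.Adj v u) :
    (advanceAll G a X v).len ≤ (X u).len + 1 := by
  have hlen := h.len_le huv
  by_cases hr : (X v).MustRetract (X '' G.neighborSet v)
  · rw [advanceAll, advance_of_mustRetract hr]
    dsimp only
    omega
  have hle : (X v).len ≤ (X u).len + 1 := by
    by_contra hlt
    exact hr ⟨X u, ⟨u, huv, rfl⟩, Or.inl (by omega)⟩
  by_cases hlt : (X v).len < (advanceAll G a X v).len
  · have hext := ((advance_of_len_lt hlt).1.1 (X u) ⟨u, huv, rfl⟩).1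
    exact len_advance_le_succ.trans (Nat.add_le_add_right hext 1)
  · omega

namespace Coherent

theorem not_mustRetract (h : Coherent G m X) (hv : (X v).Agrees m (X v).len) :
    ¬ (X v).MustRetract (X '' G.neighborSet v) := by
  rintro ⟨_, ⟨u, hu, rfl⟩, hlag | ⟨j, hj, -, hju, hlt⟩⟩
  · have hag := h.agrees_of_adj hu (hv.mono (Nat.sub_le _ 1)) (by omega)
    have := hag.1
    omega
  · have hag := h.agrees_of_adj hu (hv.mono hj.le) hj
    rw [hv.2 j hj] at hlt
    exact hlt.not_ge (h.bit_le hag hju)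

/-- A neighbour on the right track forces a node on the wrong one back: if it is not at least two
bits behind, then its string is larger at one of the last two bits. -/
theorem mustRetract {i : ℕ} (h : Coherent G m X) (huv : G.Adj v u) (hu : (X u).Agrees m (i + 1))
    (hv : ¬ (X v).Agrees m (i + 1)) (hi : i < (X v).len) :
    (X v).MustRetract (X '' G.neighborSet v) := by
  refine ⟨X u, ⟨u, huv, rfl⟩, ?_⟩
  have hlen : (X u).len ≤ i + 1 := not_lt.1 fun hlt => hv (h.agrees_of_adj huv.symm hu hlt)
  have hu' : i < (X u).len := hu.1
  have hvi : (X v).Agrees m i := h.agrees_of_adj huv.symm (hu.mono (Nat.le_succ i)) hu'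
  rcases Nat.lt_or_ge (i + 2) (X v).len with hlag | hnear
  · exact Or.inl (by omega)
  · have hne : (X v).bit i ≠ m i := fun he => hv (agrees_succ_iff.2 ⟨hvi, hi, he⟩)
    refine Or.inr ⟨i, hi, hnear, hu', ?_⟩
    rw [hu.2 i (Nat.lt_succ_self i)]
    exact (h.bit_le hvi hi).lt_of_ne hne

theorem agrees_of_mayExtend (h : Coherent G m X) (huv : G.Adj v u)
    (hext : (X v).MayExtend (a v) (X '' G.neighborSet v)) (hv : (X v).Agrees m (X v).len) :
    (X u).Agrees m (X v).len := by
  obtain ⟨hlen, hbit⟩ := hext.1 (X u) ⟨u, huv, rfl⟩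
  cases hk : (X v).len with
  | zero => exact agrees_zero _ _
  | succ k =>
    rw [hk] at hv hlen
    refine agrees_succ_iff.2 ⟨h.agrees_of_adj huv (hv.mono (Nat.le_succ k)) (by omega), hlen, ?_⟩
    rw [hbit k hk.symm, hv.2 k (Nat.lt_succ_self k)]

theorem offeredBits_le (h : Coherent G m X) (hm : ∀ v, toLex (a v) ≤ toLex m)
    (hext : (X v).MayExtend (a v) (X '' G.neighborSet v)) (hv : (X v).Agrees m (X v).len) {x : Bool}
    (hx : x ∈ (X v).offeredBits (a v) (X '' G.neighborSet v)) : x ≤ m (X v).len := by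
  rcases hx with ⟨hown, rfl⟩ | ⟨_, ⟨u, hu, rfl⟩, hlen, rfl⟩
  · exact Pi.apply_le_of_toLex (hm v) fun j hj => (hown.2 j hj).symm.trans (hv.2 j hj)
  · exact h.bit_le (h.agrees_of_mayExtend hu hext hv) hlen

theorem agrees_advanceAll {i : ℕ} (h : Coherent G m X) (hv : (X v).Agrees m i) :
    (advanceAll G a X v).Agrees m i := by
  refine (agrees_advance_iff hv.1 ?_).2 hv
  rcases hv.1.lt_or_eq with hlt | rfl
  · exact Nat.le_of_lt_succ (hlt.trans_le len_le_len_advance_succ)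
  · exact len_le_len_advance (h.not_mustRetract hv)

theorem mem_offeredBits (hinf : IsInformed G a m X v) (hv : (X v).Agrees m (X v).len) :
    m (X v).len ∈ (X v).offeredBits (a v) (X '' G.neighborSet v) := by
  rcases hinf with hl | ⟨u, hu, hag⟩
  · exact Or.inl ⟨by rwa [hl], by rw [hl]⟩
  · exact Or.inr ⟨X u, ⟨u, hu, rfl⟩, hag.1, hag.2 _ (Nat.lt_succ_self _)⟩

theorem agrees_succ_of_len_lt (h : Coherent G m X) (hm : ∀ v, toLex (a v) ≤ toLex m)
    (hinf : IsInformed G a m X v) (hv : (X v).Agrees m (X v).len)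
    (hlt : (X v).len < (advanceAll G a X v).len) :
    (advanceAll G a X v).Agrees m ((X v).len + 1) := by
  obtain ⟨hext, hbit⟩ := advance_of_len_lt hlt
  refine agrees_succ_iff.2 ⟨h.agrees_advanceAll hv, hlt, hbit.trans ?_⟩
  exact IsGreatest.csSup_eq ⟨mem_offeredBits hinf hv, fun x hx => h.offeredBits_le hm hext hv hx⟩

theorem agrees_succ_of_forall_adj (h : Coherent G m X) (hm : ∀ v, toLex (a v) ≤ toLex m)
    (hinf : IsInformed G a m X v) (hv : (X v).Agrees m (X v).len)
    (hN : ∀ u, G.Adj v u → (X u).Agrees m (X v).len) :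
    (advanceAll G a X v).Agrees m ((X v).len + 1) := by
  refine h.agrees_succ_of_len_lt hm hinf hv ?_
  have hext : (X v).MayExtend (a v) (X '' G.neighborSet v) := by
    refine ⟨?_, _, mem_offeredBits hinf hv⟩
    rintro _ ⟨u, hu, rfl⟩
    exact ⟨(hN u hu).1, fun j hj => by rw [(hN u hu).2 j (by omega), hv.2 j (by omega)]⟩
  rw [advanceAll, advance_of_mayExtend (h.not_mustRetract hv) hext]
  exact Nat.lt_succ_self _

end Coherent

theorem coherent_advanceAll (h : Coherent G m X) (hm : ∀ v, toLex (a v) ≤ toLex m) :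
    Coherent G m (advanceAll G a X) where
  len_le {u v} huv := by
    have h1 := len_advanceAll_le_of_adj (a := a) h huv
    have h2 : (X v).len ≤ (advanceAll G a X v).len + 1 := len_le_len_advance_succ
    omega
  bit_le {v i} hv hi := by
    have hle : i ≤ (X v).len := Nat.le_of_lt_succ (hi.trans_le len_advance_le_succ)
    have hag : (X v).Agrees m i := (agrees_advance_iff hle hi.le).1 hv
    rcases hle.lt_or_eq with hlt | rfl
    · exact (bit_advance hlt).trans_le (h.bit_le hag hlt)
    · obtain ⟨hext, hbit⟩ := advance_of_len_lt hi
      exact hbit.trans_le (sSup_le fun x hx => h.offeredBits_le hm hext hag hx)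
  agrees_of_adj {v u i} huv hv hi := by
    have hle : i ≤ (X v).len := Nat.le_of_lt_succ (hi.trans_le len_advance_le_succ)
    have hag : (X v).Agrees m i := (agrees_advance_iff hle hi.le).1 hv
    apply h.agrees_advanceAll
    rcases hle.lt_or_eq with hlt | rfl
    · exact h.agrees_of_adj huv hag hlt
    · exact h.agrees_of_mayExtend huv (advance_of_len_lt hi).1 hag

theorem coherent_estimate (G : SimpleGraph V) (hm : ∀ v, toLex (a v) ≤ toLex m) (t : ℕ) :
    Coherent G m (estimate G a t) := by
  induction t with
  | zero => exact ⟨fun _ => Nat.zero_le _, fun _ hi => absurd hi (Nat.not_lt_zero _),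
      fun _ _ hi => absurd hi (Nat.not_lt_zero _)⟩
  | succ t ih => exact coherent_advanceAll ih hm

variable {l : V}

theorem agrees_len_estimate (G : SimpleGraph V) (hl : ∀ v, toLex (a v) ≤ toLex (a l)) (t : ℕ) :
    (estimate G a t l).Agrees (a l) (estimate G a t l).len := by
  induction t with
  | zero => exact agrees_zero _ _
  | succ t ih =>
    have h := coherent_estimate G hl t
    rcases Nat.lt_or_ge (estimate G a t l).len (estimate G a (t + 1) l).len with hlt | hge
    · exact (h.agrees_succ_of_len_lt hl (Or.inl rfl) ih hlt).mono len_advance_le_succ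
    · exact (h.agrees_advanceAll ih).mono hge

theorem dist_le_dist_add_one_of_adj (hG : G.Connected) (w : V) (huv : G.Adj u v) :
    G.dist u w ≤ G.dist v w + 1 := by
  have := hG.dist_triangle (u := u) (v := v) (w := w)
  rw [SimpleGraph.dist_eq_one_iff_adj.2 huv] at this
  omega

theorem exists_adj_dist_add_one_eq (hG : G.Connected) {w : V} (hd : 0 < G.dist v w) :
    ∃ u, G.Adj v u ∧ G.dist u w + 1 = G.dist v w := by
  obtain ⟨p, hp⟩ := hG.exists_walk_length_eq_dist v w
  cases p with
  | nil => simp at hd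
  | @cons _ u _ hu p =>
    refine ⟨u, hu, le_antisymm ?_ (dist_le_dist_add_one_of_adj hG w hu)⟩
    rw [← hp, SimpleGraph.Walk.length_cons]
    exact Nat.add_le_add_right (SimpleGraph.dist_le p) 1

/-- The number of synchronous steps within which a node at distance `d` from the leader gets the
first `i` bits right. -/
def deadline (i d : ℕ) : ℕ := 3 * i + 2 * d

/-- The progress of a node at distance `d` from the leader in its first `i` bits after `t` steps:
its estimate `s` has them right, or the deadline for this has not passed and enough time is left to
withdraw the excess of `s`. -/
def IsOnTime (m : ℕ → Bool) (i d t : ℕ) (s : BitPrefix) : Prop :=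
  s.Agrees m i ∨ t ≤ deadline i d ∧ s.len + t < i + deadline i d

theorem agrees_of_isOnTime {i d t : ℕ} {s : BitPrefix} (h : IsOnTime m i d t s)
    (ht : deadline i d < t) : s.Agrees m i :=
  h.resolve_right fun hlate => ht.not_ge hlate.1

/-- A node that has just the first `i` bits right gets the next one in time: at its deadline, all
the neighbours have passed the deadline for `i` bits. -/
theorem isOnTime_succ_of_len_eq {i t : ℕ} (hG : G.Connected)
    (hl : ∀ v, toLex (a v) ≤ toLex (a l))
    (hpast : ∀ w, IsOnTime (a l) i (G.dist w l) t (estimate G a t w))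
    (hv : (estimate G a t v).Agrees (a l) i) (hi : (estimate G a t v).len = i)
    (hinf : IsInformed G a (a l) (estimate G a t) v) (ht : t ≤ deadline (i + 1) (G.dist v l)) :
    IsOnTime (a l) (i + 1) (G.dist v l) (t + 1) (estimate G a (t + 1) v) := by
  subst hi
  have h := coherent_estimate G hl t
  rcases ht.lt_or_eq with ht | ht
  · rcases Nat.lt_or_ge (estimate G a t v).len (estimate G a (t + 1) v).len with hlt | hge
    · exact Or.inl (h.agrees_succ_of_len_lt hl hinf hv hlt)
    · exact Or.inr ⟨ht, by omega⟩
  · refine Or.inl (h.agrees_succ_of_forall_adj hl hinf hv fun u hu =>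
      agrees_of_isOnTime (hpast u) ?_)
    have := dist_le_dist_add_one_of_adj hG l hu.symm
    unfold deadline at ht ⊢
    omega

theorem isOnTime_succ_self {i t : ℕ} (hG : G.Connected) (hl : ∀ v, toLex (a v) ≤ toLex (a l))
    (ih : ∀ v i, IsOnTime (a l) i (G.dist v l) t (estimate G a t v)) :
    IsOnTime (a l) (i + 1) (G.dist l l) (t + 1) (estimate G a (t + 1) l) := by
  have hown := agrees_len_estimate G hl t
  rcases ih l (i + 1) with hv | ⟨ht, -⟩
  · exact Or.inl ((coherent_estimate G hl t).agrees_advanceAll hv)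
  rcases Nat.lt_trichotomy (estimate G a t l).len i with hlt | hi | hgt
  · obtain ⟨hti, hlen⟩ := (ih l i).resolve_left fun hag => hag.1.not_gt hlt
    have : (estimate G a (t + 1) l).len ≤ (estimate G a t l).len + 1 := len_advance_le_succ
    right
    unfold deadline at *
    omega
  · exact isOnTime_succ_of_len_eq hG hl (ih · i) (hi ▸ hown) hi (Or.inl rfl) ht
  · exact Or.inl ((coherent_estimate G hl t).agrees_advanceAll (hown.mono hgt))

theorem isOnTime_succ_of_adj {i t : ℕ} (hG : G.Connected) (hl : ∀ v, toLex (a v) ≤ toLex (a l))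
    (ih : ∀ v i, IsOnTime (a l) i (G.dist v l) t (estimate G a t v))
    (hvu : G.Adj v u) (hdu : G.dist u l + 1 = G.dist v l) :
    IsOnTime (a l) (i + 1) (G.dist v l) (t + 1) (estimate G a (t + 1) v) := by
  have h := coherent_estimate G hl t
  by_cases hv : (estimate G a t v).Agrees (a l) (i + 1)
  · exact Or.inl (h.agrees_advanceAll hv)
  obtain ⟨ht, hlen⟩ := (ih v (i + 1)).resolve_left hv
  rcases ih u (i + 1) with hu | hlate
  · rcases Nat.lt_or_ge i (estimate G a t v).len with hlt | hge
    · rw [estimate, advanceAll, advance_of_mustRetract (h.mustRetract hvu hu hv hlt)]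
      right
      dsimp only
      omega
    · have hvi := h.agrees_of_adj hvu.symm (hu.mono (Nat.le_succ i)) hu.1
      have hi := hge.antisymm hvi.1
      exact isOnTime_succ_of_len_eq hG hl (ih · i) hvi hi (Or.inr ⟨u, hvu, hi ▸ hu⟩) ht
  · have : (estimate G a (t + 1) v).len ≤ (estimate G a t u).len + 1 :=
      len_advanceAll_le_of_adj h hvu
    right
    unfold deadline at *
    omega

theorem isOnTime_estimate (hG : G.Connected) (hl : ∀ v, toLex (a v) ≤ toLex (a l)) (t : ℕ) :
    ∀ v i, IsOnTime (a l) i (G.dist v l) t (estimate G a t v) := by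
  induction t with
  | zero =>
    rintro v (_ | i)
    · exact Or.inl (agrees_zero _ _)
    · exact Or.inr ⟨Nat.zero_le _, by simp [estimate, empty]⟩
  | succ t ih =>
    rintro v (_ | i)
    · exact Or.inl (agrees_zero _ _)
    rcases Nat.eq_zero_or_pos (G.dist v l) with hd | hd
    · obtain rfl : v = l := hG.dist_eq_zero_iff.1 hd
      exact isOnTime_succ_self hG hl ih
    · obtain ⟨u, hvu, hdu⟩ := exists_adj_dist_add_one_eq hG hd
      exact isOnTime_succ_of_adj hG hl ih hvu hdu

end Evolution

namespace BitPrefix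

/-- What a node makes public about its estimate: the length modulo `5`, and the last five bits,
indexed by their positions modulo `5`. The lengths at neighbouring nodes differ by at most `2`, so
that this number of residues tells them apart. -/
abbrev Code : Type := ZMod 5 × (ZMod 5 → Bool)

open Classical in
/-- The public part of an estimate. -/
noncomputable def code (s : BitPrefix) : Code :=
  (s.len, fun r => decide (∃ j < s.len, s.len ≤ j + 5 ∧ (j : ZMod 5) = r ∧ s.bit j = true))

/-- The number that differs from `n` by at most `2` and has the residue `r`. -/
def nearbyLength (n : ℕ) (r : ZMod 5) : ℕ := n + (r - n + 2).val - 2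

/-- What a node with an estimate of length `n` reconstructs from the code of a neighbour. -/
def decode (n : ℕ) (c : Code) : BitPrefix := ⟨nearbyLength n c.1, fun j => c.2 j⟩

/-- One step of a node that hears the codes `O`. A node cannot hear its own code, because its
neighbours announce it at the time when the node does so itself; therefore this code is added. -/
noncomputable def advanceHeard (a : ℕ → Bool) (s : BitPrefix) (O : Set Code) : BitPrefix :=
  s.advance a (decode s.len '' insert s.code O)

variable {a : ℕ → Bool} {s u : BitPrefix} {N : Set BitPrefix} {n j : ℕ}

theorem nearbyLength_natCast {k : ℕ} (hk : k ≤ n + 2) (hn : n ≤ k + 2) :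
    nearbyLength n (k : ZMod 5) = k := by
  have hcast : (k : ZMod 5) - n + 2 = ((k + 2 - n : ℕ) : ZMod 5) := by
    rw [Nat.cast_sub hn]
    push_cast
    ring
  rw [nearbyLength, hcast, ZMod.val_natCast_of_lt (by omega)]
  omega

theorem len_decode_code (hu : u.len ≤ n + 2) (hn : n ≤ u.len + 2) :
    (decode n u.code).len = u.len :=
  nearbyLength_natCast hu hn

theorem bit_decode_code (hj : j < u.len) (hu : u.len ≤ j + 5) :
    (decode n u.code).bit j = u.bit j := by
  rw [Bool.eq_iff_iff]
  simp only [decode, code, decide_eq_true_eq]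
  refine ⟨?_, fun h => ⟨j, hj, hu, rfl, h⟩⟩
  rintro ⟨k, hk, huk, hkj, hbit⟩
  rw [ZMod.natCast_eq_natCast_iff'] at hkj
  obtain rfl : k = j := by omega
  exact hbit

theorem advance_congr {N' : Set BitPrefix} (hr : s.MustRetract N ↔ s.MustRetract N')
    (he : s.MayExtend a N ↔ s.MayExtend a N')
    (ho : s.offeredBits a N = s.offeredBits a N') : s.advance a N = s.advance a N' := by
  classical
  rw [advance, ho]
  exact if_congr hr rfl (if_congr he rfl rfl)

theorem advance_insert_self : s.advance a (insert s N) = s.advance a N := by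
  have ho : s.offeredBits a (insert s N) = s.offeredBits a N := by simp [offeredBits]
  exact advance_congr (by simp [MustRetract]) (by simp [MayExtend, ho]) ho

theorem advance_image {f : BitPrefix → BitPrefix} (hlen : ∀ u ∈ N, (f u).len = u.len)
    (hbit : ∀ u ∈ N, ∀ j < u.len, s.len ≤ j + 2 → (f u).bit j = u.bit j) :
    s.advance a (f '' N) = s.advance a N := by
  have ho : s.offeredBits a (f '' N) = s.offeredBits a N := by
    ext x
    simp only [offeredBits, Set.exists_mem_image]
    grind
  refine advance_congr ?_ ?_ ho
  · simp only [MustRetract, Set.exists_mem_image]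
    refine exists_congr fun u => and_congr_right fun hu => ?_
    rw [hlen u hu]
    refine or_congr_right (exists_congr fun j => and_congr_right fun _ => and_congr_right fun hs =>
      and_congr_right fun hj => ?_)
    rw [hbit u hu j hj hs]
  · simp only [MayExtend, ho, Set.forall_mem_image]
    grind

theorem advanceHeard_eq {O : Set Code} (hN : ∀ u ∈ N, u.len ≤ s.len + 2 ∧ s.len ≤ u.len + 2)
    (hO : ∀ c, c ≠ s.code → (c ∈ O ↔ c ∈ code '' N)) :
    s.advanceHeard a O = s.advance a N := by
  have hins : insert s.code O = code '' insert s N := by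
    ext c
    rw [Set.image_insert_eq, Set.mem_insert_iff, Set.mem_insert_iff]
    exact or_congr_right' (hO c)
  have hnear : ∀ u ∈ insert s N, u.len ≤ s.len + 2 ∧ s.len ≤ u.len + 2 :=
    Set.forall_mem_insert.2 ⟨by omega, hN⟩
  rw [advanceHeard, hins, Set.image_image,
    advance_image (fun u hu => len_decode_code (hnear u hu).1 (hnear u hu).2)
      fun u hu j hj hs => bit_decode_code hj (by have := (hnear u hu).1; omega),
    advance_insert_self]

end BitPrefix

section WakeTime

variable {V : Type*} {G : SimpleGraph V} {W : Set V} {u v w : V}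

/-- The distance of a node to the set `W` of the nodes that are awake at the beginning, that is, the
round in which the wave of noise that starts from `W` wakes it up. -/
noncomputable def wakeTime (G : SimpleGraph V) (W : Set V) (v : V) : ℕ := sInf (G.dist v '' W)

theorem wakeTime_le_dist (hw : w ∈ W) (v : V) : wakeTime G W v ≤ G.dist v w :=
  Nat.sInf_le ⟨w, hw, rfl⟩

theorem exists_dist_eq_wakeTime (hW : W.Nonempty) (v : V) : ∃ w ∈ W, G.dist v w = wakeTime G W v :=
  Nat.sInf_mem (hW.image _)

theorem wakeTime_eq_zero_iff (hG : G.Connected) (hW : W.Nonempty) :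
    wakeTime G W v = 0 ↔ v ∈ W := by
  constructor
  · intro h
    obtain ⟨w, hw, hd⟩ := exists_dist_eq_wakeTime (G := G) hW v
    rwa [hG.dist_eq_zero_iff.1 (hd.trans h)]
  · intro h
    simpa using wakeTime_le_dist (G := G) h v

theorem wakeTime_le_of_adj (hG : G.Connected) (hW : W.Nonempty) (huv : G.Adj u v) :
    wakeTime G W u ≤ wakeTime G W v + 1 := by
  obtain ⟨w, hw, hd⟩ := exists_dist_eq_wakeTime (G := G) hW v
  exact hd ▸ (wakeTime_le_dist hw u).trans (dist_le_dist_add_one_of_adj hG w huv)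

theorem exists_adj_wakeTime_add_one_eq (hG : G.Connected) (hW : W.Nonempty)
    (hv : 0 < wakeTime G W v) : ∃ u, G.Adj v u ∧ wakeTime G W u + 1 = wakeTime G W v := by
  obtain ⟨w, hw, hd⟩ := exists_dist_eq_wakeTime (G := G) hW v
  obtain ⟨u, hu, hdu⟩ := exists_adj_dist_add_one_eq hG (hd ▸ hv)
  have hle := wakeTime_le_dist (G := G) hw u
  have hge := wakeTime_le_of_adj hG hW hu
  exact ⟨u, hu, by omega⟩

end WakeTime

section Schedule

variable {a h h' : ℕ → Bool} {s s' k : ℕ} {c c' : Code}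

/-- The number of codes, each of which has its own three rounds in a slot. -/
def slotLength : ℕ := Fintype.card Code

/-- The place of the code `c` in a slot. -/
noncomputable def codeIndex (c : Code) : ℕ := Fintype.equivFin Code c

/-- The local clock of a node, which counts the rounds since it woke up, at the beginning of slot
`s`. The offset keeps the slots apart from the noise by which the neighbours are woken up. -/
def slotStart (s : ℕ) : ℕ := 3 * (slotLength * s) + 3

/-- The local clock at the first of the three rounds for the code `c` in slot `s`. There are three
of them since the clocks of neighbours may differ by one: what a node announces in the middle one is
heard by its neighbours in one of the three. -/
noncomputable def announceTime (s : ℕ) (c : Code) : ℕ := slotStart s + 3 * codeIndex c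

theorem codeIndex_lt_slotLength (c : Code) : codeIndex c < slotLength :=
  (Fintype.equivFin Code c).isLt

theorem codeIndex_injective : Function.Injective codeIndex :=
  Fin.val_injective.comp (Fintype.equivFin Code).injective

theorem slotStart_le_announceTime (s : ℕ) (c : Code) : slotStart s ≤ announceTime s c :=
  Nat.le_add_right _ _

theorem announceTime_add_two_lt (s : ℕ) (c : Code) : announceTime s c + 2 < slotStart (s + 1) := by
  have := codeIndex_lt_slotLength c
  unfold announceTime slotStart
  rw [Nat.mul_succ]
  omega

theorem announceTime_inj {d d' : ℕ} (h : announceTime s c + d = announceTime s' c' + d')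
    (hd : d ≤ d' + 2) (hd' : d' ≤ d + 2) : s = s' ∧ c = c' := by
  have hindex : slotLength * s + codeIndex c = slotLength * s' + codeIndex c' := by
    unfold announceTime slotStart at h
    omega
  have hc := codeIndex_lt_slotLength c
  have hc' := codeIndex_lt_slotLength c'
  obtain rfl : s = s' := by
    have := congrArg (· / slotLength) hindex
    simpa [Nat.mul_add_div (Nat.zero_lt_of_lt hc), Nat.div_eq_of_lt hc, Nat.div_eq_of_lt hc']
      using this
  exact ⟨rfl, codeIndex_injective (Nat.add_left_cancel hindex)⟩

/-- The codes heard in slot `s`, when `h` tells at which times of the local clock something was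
heard. -/
def heardCodes (h : ℕ → Bool) (s : ℕ) : Set Code :=
  {c | ∃ r < 3, h (announceTime s c + r) = true}

/-- The estimate of a node with identifier `a` at the beginning of slot `s`, computed from what it
has heard. -/
noncomputable def replay (a h : ℕ → Bool) : ℕ → BitPrefix
  | 0 => empty
  | s + 1 => (replay a h s).advanceHeard a (heardCodes h s)

/-- Whether a node transmits when its local clock shows `k`: it wakes up its neighbours in its first
round, and later announces the code of its estimate once in every slot. -/
def TransmitsAt (a h : ℕ → Bool) (k : ℕ) : Prop :=
  k = 0 ∨ ∃ s, k = announceTime s (replay a h s).code + 1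

theorem replay_congr (hh : ∀ k < slotStart s, h k = h' k) : replay a h s = replay a h' s := by
  induction s with
  | zero => rfl
  | succ s ih =>
    have hcodes : heardCodes h s = heardCodes h' s := by
      ext c
      refine exists_congr fun r => and_congr_right fun hr => ?_
      have := announceTime_add_two_lt s c
      rw [hh _ (by omega)]
    rw [replay, replay, hcodes, ih fun k hk => hh k ?_]
    have := slotStart_le_announceTime s empty.code
    have := announceTime_add_two_lt s empty.code
    omega

theorem TransmitsAt.congr (hk : TransmitsAt a h k) (hh : ∀ j < k, h j = h' j) :
    TransmitsAt a h' k := by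
  refine hk.imp_right fun ⟨s, hs⟩ => ⟨s, ?_⟩
  have := slotStart_le_announceTime s (replay a h s).code
  rwa [← replay_congr fun j hj => hh j (by omega)]

theorem transmitsAt_congr (hh : ∀ j < k, h j = h' j) : TransmitsAt a h k ↔ TransmitsAt a h' k :=
  ⟨fun hk => hk.congr hh, fun hk => hk.congr fun j hj => (hh j hj).symm⟩

end Schedule

/-- In the medium `m`, a node is woken up, and an awake one can tell, exactly if it is silent and
some neighbour transmits. This is all that the election protocol needs of the medium. -/
def Medium.DetectsNoise (m : Medium) : Prop :=
  ∀ {V : Type} [Fintype V] (G : SimpleGraph V) (x : V → Option m.Packet) (v : V),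
    m.wakes (m.observe G x v) = true ↔ x v = none ∧ ∃ u, G.Adj v u ∧ x u ≠ none

theorem beepMedium_detectsNoise : beepMedium.DetectsNoise := by
  intro V _ G x v
  simp [beepMedium]

theorem radioMedium_detectsNoise (k : ℕ) : (radioMedium k).DetectsNoise := by
  classical
  intro V _ G x v
  change RadioObs.wakes (if x v = none then _ else _) = true ↔ _
  by_cases hv : x v = none
  · have hnil : (G.neighborFinset v).toList.filterMap x ≠ [] ↔ ∃ u, G.Adj v u ∧ x u ≠ none := by
      rw [Ne, List.filterMap_eq_nil_iff]
      simp
    have hwakes : ∀ L : List (Fin k → Bool), RadioObs.wakes (match L with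
        | [] => .silence
        | [p] => .packet p
        | _ => .collision) = true ↔ L ≠ [] := by
      rintro (_ | ⟨p, _ | ⟨p', L⟩⟩) <;> simp [RadioObs.wakes]
    rw [if_pos hv]
    simp only [hv, true_and]
    exact (hwakes _).trans hnil
  · rw [if_neg hv]
    simp [RadioObs.wakes, hv]

namespace Protocol

variable {m : Medium} {b r : ℕ} {V : Type} [Fintype V] {P : Protocol m b r} {G : SimpleGraph V}
  {W : Set V} {ω : V → Seed b r} {t : ℕ} {v : V}

/-- What the nodes transmit in round `t`. -/
noncomputable def transmissionAt (P : Protocol m b r) (G : SimpleGraph V) (W : Set V)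
    (ω : V → Seed b r) (t : ℕ) (v : V) : Option m.Packet :=
  (P.config G W ω t v).bind P.transmit

/-- Whether `v` hears a noise in round `t`. -/
noncomputable def hearsAt (P : Protocol m b r) (G : SimpleGraph V) (W : Set V) (ω : V → Seed b r)
    (t : ℕ) (v : V) : Bool :=
  m.wakes (m.observe G (P.transmissionAt G W ω t) v)

theorem config_succ_of_eq_some {s : P.State} (h : P.config G W ω t v = some s) :
    P.config G W ω (t + 1) v =
      some (P.next s (m.observe G (P.transmissionAt G W ω t) v)) := by
  simp only [config, h]
  rfl

theorem config_succ_of_eq_none (h : P.config G W ω t v = none) :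
    P.config G W ω (t + 1) v = if P.hearsAt G W ω t v then
      some (P.wake (ω v) (m.observe G (P.transmissionAt G W ω t) v)) else none := by
  simp only [config, h]
  rfl

theorem config_of_le_wakeTime (hm : m.DetectsNoise) (hG : G.Connected) (hW : W.Nonempty)
    (hstart : ∀ σ, P.transmit (P.start σ) ≠ none) (hwake : ∀ σ o, P.wake σ o = P.start σ)
    (ht : t ≤ wakeTime G W v) :
    P.config G W ω t v = if t = wakeTime G W v then some (P.start (ω v)) else none := by
  induction t generalizing v with
  | zero => simp only [config, ← wakeTime_eq_zero_iff hG hW, eq_comm]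
  | succ t ih =>
    have hasleep : P.config G W ω t v = none := by
      rw [ih (by omega), if_neg (by omega)]
    have hhears : P.hearsAt G W ω t v = true ↔ t + 1 = wakeTime G W v := by
      rw [hearsAt, hm]
      constructor
      · rintro ⟨-, u, hu, hne⟩
        by_contra hlt
        have := wakeTime_le_of_adj hG hW hu
        rw [transmissionAt, ih (by omega), if_neg (by omega)] at hne
        exact hne rfl
      · intro heq
        obtain ⟨u, hu, hd⟩ := exists_adj_wakeTime_add_one_eq hG hW (v := v) (by omega)
        refine ⟨by rw [transmissionAt, hasleep, Option.bind_none], u, hu, ?_⟩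
        rw [transmissionAt, ih (by omega), if_pos (by omega)]
        exact hstart _
    simp only [config_succ_of_eq_none hasleep, hhears, hwake]

end Protocol

/-- An identifier as an infinite sequence of bits, padded with zeros. -/
def idBits {b : ℕ} (i : Fin b → Bool) (j : ℕ) : Bool := if h : j < b then i ⟨j, h⟩ else false

/-- The list `l` of what was heard so far as a sequence, with silence in the future. -/
def record (l : List Bool) (j : ℕ) : Bool := l.getD j false

open Classical in
/-- The leader election protocol: `p` is the packet that is sent in order to make a noise, and the
identifier found is output after `R` slots. The state consists of the seed and the list of what was
heard since the node woke up; the length of the list is the local clock. -/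
noncomputable def electionProtocol (m : Medium) (p : m.Packet) (b r R : ℕ) : Protocol m b r where
  State := Seed b r × List Bool
  start σ := (σ, [])
  wake σ _ := (σ, [])
  transmit s := if TransmitsAt (idBits s.1.1) (record s.2) s.2.length then some p else none
  next s o := (s.1, s.2 ++ [m.wakes o])
  output s :=
    if slotStart R ≤ s.2.length then some fun i => (replay (idBits s.1.1) (record s.2) R).bit i
    else none

section Execution

variable {m : Medium} {p : m.Packet} {b r R : ℕ} {V : Type} [Fintype V] {G : SimpleGraph V}
  {W : Set V} {ω : V → Seed b r} {v : V} {t k s : ℕ}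

/-- Whether `v` hears something when its local clock shows `k`. -/
noncomputable def hearing (p : m.Packet) (R : ℕ) (G : SimpleGraph V) (W : Set V)
    (ω : V → Seed b r) (v : V) (k : ℕ) : Bool :=
  (electionProtocol m p b r R).hearsAt G W ω (wakeTime G W v + k) v

theorem record_map_range {h : ℕ → Bool} {j : ℕ} (hj : j < k) :
    record ((List.range k).map h) j = h j := by
  simp [record, hj]

theorem transmit_start_ne_none (σ : Seed b r) : (electionProtocol m p b r R).transmit
    ((electionProtocol m p b r R).start σ) ≠ none := by
  simp [electionProtocol, TransmitsAt]

theorem config_wakeTime_add (hm : m.DetectsNoise) (hG : G.Connected) (hW : W.Nonempty) (v : V)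
    (k : ℕ) : (electionProtocol m p b r R).config G W ω (wakeTime G W v + k) v =
      some (ω v, (List.range k).map (hearing p R G W ω v)) := by
  induction k with
  | zero =>
    exact (Protocol.config_of_le_wakeTime hm hG hW transmit_start_ne_none (fun _ _ => rfl)
      le_rfl).trans (if_pos rfl)
  | succ k ih =>
    rw [← Nat.add_assoc, Protocol.config_succ_of_eq_some ih, List.range_succ, List.map_append]
    rfl

theorem config_of_lt_wakeTime (hm : m.DetectsNoise) (hG : G.Connected) (hW : W.Nonempty)
    (ht : t < wakeTime G W v) : (electionProtocol m p b r R).config G W ω t v = none :=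
  (Protocol.config_of_le_wakeTime hm hG hW transmit_start_ne_none (fun _ _ => rfl) ht.le).trans
    (if_neg ht.ne)

theorem transmissionAt_ne_none_iff (hm : m.DetectsNoise) (hG : G.Connected) (hW : W.Nonempty) :
    (electionProtocol m p b r R).transmissionAt G W ω t v ≠ none ↔
      ∃ k, t = wakeTime G W v + k ∧ TransmitsAt (idBits (ω v).1) (hearing p R G W ω v) k := by
  rw [Protocol.transmissionAt]
  rcases Nat.lt_or_ge t (wakeTime G W v) with hlt | hge
  · rw [config_of_lt_wakeTime hm hG hW hlt]
    refine iff_of_false (fun hne => hne rfl) ?_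
    rintro ⟨k, hk, -⟩
    omega
  · obtain ⟨k, rfl⟩ := Nat.exists_eq_add_of_le hge
    rw [config_wakeTime_add hm hG hW]
    simp [electionProtocol, transmitsAt_congr fun _ hj => record_map_range hj]

theorem hearing_eq_true_iff (hm : m.DetectsNoise) (hG : G.Connected) (hW : W.Nonempty) :
    hearing p R G W ω v k = true ↔ ¬ TransmitsAt (idBits (ω v).1) (hearing p R G W ω v) k ∧
      ∃ u, G.Adj v u ∧ ∃ k', wakeTime G W v + k = wakeTime G W u + k' ∧
        TransmitsAt (idBits (ω u).1) (hearing p R G W ω u) k' := by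
  rw [hearing, Protocol.hearsAt, hm, ← not_ne_iff (a := Protocol.transmissionAt ..)]
  simp only [transmissionAt_ne_none_iff hm hG hW, Nat.add_left_cancel_iff, exists_eq_left']

theorem mem_heardCodes_hearing_iff (hm : m.DetectsNoise) (hG : G.Connected) (hW : W.Nonempty)
    {c : Code} (hc : c ≠ (replay (idBits (ω v).1) (hearing p R G W ω v) s).code) :
    c ∈ heardCodes (hearing p R G W ω v) s ↔
      ∃ u, G.Adj v u ∧ (replay (idBits (ω u).1) (hearing p R G W ω u) s).code = c := by
  constructor
  · rintro ⟨j, hj, hh⟩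
    obtain ⟨-, u, hu, k, hk, hT⟩ := (hearing_eq_true_iff hm hG hW).1 hh
    have hvu := wakeTime_le_of_adj hG hW hu
    have huv := wakeTime_le_of_adj hG hW hu.symm
    rcases hT with rfl | ⟨s', rfl⟩
    · have := slotStart_le_announceTime s c
      unfold slotStart at this
      omega
    · obtain ⟨rfl, rfl⟩ := announceTime_inj (s := s) (s' := s') (c := c)
        (c' := (replay (idBits (ω u).1) (hearing p R G W ω u) s').code) (d := wakeTime G W v + j)
        (d' := wakeTime G W u + 1) (by omega) (by omega) (by omega)
      exact ⟨u, hu, rfl⟩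
  · rintro ⟨u, hu, rfl⟩
    have hvu := wakeTime_le_of_adj hG hW hu
    have huv := wakeTime_le_of_adj hG hW hu.symm
    refine ⟨wakeTime G W u + 1 - wakeTime G W v, by omega,
      (hearing_eq_true_iff hm hG hW).2 ⟨?_, u, hu, _, by omega, Or.inr ⟨s, rfl⟩⟩⟩
    rintro (hT | ⟨s', hT⟩)
    · have := slotStart_le_announceTime s
        (replay (idBits (ω u).1) (hearing p R G W ω u) s).code
      unfold slotStart at this
      omega
    · obtain ⟨rfl, he⟩ := announceTime_inj hT (by omega) (by omega)
      exact hc he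

theorem replay_hearing (hm : m.DetectsNoise) (hG : G.Connected) (hW : W.Nonempty) {l : V}
    (hl : ∀ v, toLex (idBits (ω v).1) ≤ toLex (idBits (ω l).1)) (s : ℕ) (v : V) :
    replay (idBits (ω v).1) (hearing p R G W ω v) s = estimate G (fun v => idBits (ω v).1) s v := by
  induction s generalizing v with
  | zero => rfl
  | succ s ih =>
    have hlen {u w : V} := (coherent_estimate G hl s).len_le (u := u) (v := w)
    rw [replay, estimate, advanceAll, ih v]
    refine advanceHeard_eq ?_ fun c hc => ?_
    · rintro _ ⟨u, hu, rfl⟩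
      exact ⟨hlen hu.symm, hlen hu⟩
    · rw [mem_heardCodes_hearing_iff hm hG hW (by rwa [ih v])]
      simp only [ih, Set.mem_image, SimpleGraph.mem_neighborSet, exists_exists_and_eq_and]

theorem agrees_replay_hearing (hm : m.DetectsNoise) (hG : G.Connected) (hW : W.Nonempty) {l : V}
    (hl : ∀ v, toLex (idBits (ω v).1) ≤ toLex (idBits (ω l).1))
    (hR : deadline b G.diam < R) (v : V) :
    (replay (idBits (ω v).1) (hearing p R G W ω v) R).Agrees (idBits (ω l).1) b := by
  rw [replay_hearing hm hG hW hl]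
  have := hG.nonempty
  have hdiam : G.dist v l ≤ G.diam :=
    SimpleGraph.dist_le_diam (SimpleGraph.connected_iff_ediam_ne_top.1 hG)
  refine agrees_of_isOnTime (isOnTime_estimate hG hl R v b) (lt_of_le_of_lt ?_ hR)
  unfold deadline
  omega

theorem outputAt_electionProtocol (hm : m.DetectsNoise) (hG : G.Connected) (hW : W.Nonempty) {l : V}
    (hl : ∀ v, toLex (idBits (ω v).1) ≤ toLex (idBits (ω l).1))
    (hR : deadline b G.diam < R) (t : ℕ) (v : V) :
    (electionProtocol m p b r R).outputAt G W ω t v =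
      if wakeTime G W v + slotStart R ≤ t then some (ω l).1 else none := by
  rw [Protocol.outputAt]
  rcases Nat.lt_or_ge t (wakeTime G W v) with hlt | hge
  · rw [config_of_lt_wakeTime hm hG hW hlt, if_neg (by omega), Option.bind_none]
  obtain ⟨k, rfl⟩ := Nat.exists_eq_add_of_le hge
  rw [config_wakeTime_add hm hG hW]
  change (if slotStart R ≤ _ then _ else _) = _
  simp only [List.length_map, List.length_range, Nat.add_le_add_iff_left]
  refine if_ctx_congr Iff.rfl (fun hk => ?_) fun _ => rfl
  rw [replay_congr fun _ hj => record_map_range (hj.trans_le hk)]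
  have hag := agrees_replay_hearing (p := p) hm hG hW hl hR v
  congr with i
  rw [hag.2 i i.isLt, idBits, dif_pos i.isLt]

theorem electionProtocol_electsLeaderBy {T : ℝ} (hm : m.DetectsNoise) (hG : G.Connected)
    (hW : W.Nonempty) (hω : Function.Injective fun v => (ω v).1) (hR : deadline b G.diam < R)
    (hT : (G.diam + slotStart R : ℕ) ≤ T) :
    (electionProtocol m p b r R).ElectsLeaderBy G W ω T := by
  have := hG.nonempty
  obtain ⟨l, hl⟩ := Finite.exists_max fun v => toLex (idBits (ω v).1)
  have hout := outputAt_electionProtocol (p := p) (R := R) hm hG hW hl hR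
  refine ⟨l, fun v hv => hω hv, fun t v i hi => ?_, fun t v ht => ?_⟩
  · rw [hout] at hi
    split_ifs at hi
    exact (Option.some.inj hi).symm
  · obtain ⟨w, hw⟩ := hW
    have hwake : wakeTime G W v ≤ G.diam := (wakeTime_le_dist hw v).trans
      (SimpleGraph.dist_le_diam (SimpleGraph.connected_iff_ediam_ne_top.1 hG))
    have ht' : G.diam + slotStart R ≤ t := by exact_mod_cast hT.trans ht
    rw [hout, if_pos (by omega)]

end Execution

theorem uniformProb_mono {Ω : Type} [Fintype Ω] {E F : Ω → Prop} (h : ∀ x, E x → F x) :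
    uniformProb E ≤ uniformProb F := by
  unfold uniformProb
  gcongr with x
  exact h x

theorem one_sub_sq_div_le_descFactorial_div_pow {K : ℕ} (hK : 0 < K) (n : ℕ) :
    1 - (n : ℝ) ^ 2 / K ≤ (K.descFactorial n : ℝ) / (K : ℝ) ^ n := by
  have hK' : (0 : ℝ) < K := by exact_mod_cast hK
  rcases Nat.lt_or_ge K n with hlt | hge
  · have hnK : (K : ℝ) ≤ (n : ℝ) ^ 2 := by
      exact_mod_cast hlt.le.trans (Nat.le_self_pow two_ne_zero n)
    exact (sub_nonpos.2 ((one_le_div hK').2 hnK)).trans (by positivity)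
  · have hnK : (n : ℝ) ≤ K := by exact_mod_cast hge
    have hratio : (n : ℝ) / K ≤ 1 := (div_le_one hK').2 hnK
    have hdesc : ((K : ℝ) - n) ^ n ≤ K.descFactorial n := by
      have hle : ((K - n : ℕ) : ℝ) ^ n ≤ K.descFactorial n := by
        exact_mod_cast (Nat.pow_le_pow_left (by omega) n).trans (Nat.pow_sub_le_descFactorial K n)
      rwa [Nat.cast_sub hge] at hle
    calc 1 - (n : ℝ) ^ 2 / K = 1 + n * (-((n : ℝ) / K)) := by ring
      _ ≤ (1 + -((n : ℝ) / K)) ^ n := one_add_mul_le_pow (by linarith) n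
      _ = ((K : ℝ) - n) ^ n / (K : ℝ) ^ n := by
        rw [← div_pow, sub_div, div_self hK'.ne', sub_eq_add_neg]
      _ ≤ K.descFactorial n / (K : ℝ) ^ n := by gcongr

theorem uniformProb_injective (V S : Type) [Fintype V] [DecidableEq V] [Fintype S] :
    uniformProb (fun ω : V → S => Function.Injective ω) =
      ((Fintype.card S).descFactorial (Fintype.card V) : ℝ) /
        (Fintype.card S : ℝ) ^ Fintype.card V := by
  classical
  have hcard : (Finset.univ.filter fun ω : V → S => Function.Injective ω).card =
      (Fintype.card S).descFactorial (Fintype.card V) := by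
    rw [← Fintype.card_embedding_eq, ← Fintype.card_subtype]
    exact Fintype.card_congr (Equiv.subtypeInjectiveEquivEmbedding V S)
  rw [uniformProb, ← hcard, Fintype.card_fun, Nat.cast_pow]
  congr!

theorem one_sub_one_div_pow_le_uniformProb_injective {V S : Type} [Fintype V] [DecidableEq V]
    [Nonempty V] [Fintype S] {c : ℕ} (h : Fintype.card V ^ (c + 2) ≤ Fintype.card S) :
    1 - 1 / (Fintype.card V : ℝ) ^ c ≤ uniformProb (fun ω : V → S => Function.Injective ω) := by
  have hV : 0 < Fintype.card V := Fintype.card_pos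
  have hS : 0 < Fintype.card S := (pow_pos hV _).trans_le h
  rw [uniformProb_injective]
  refine le_trans (sub_le_sub_left ?_ 1) (one_sub_sq_div_le_descFactorial_div_pow hS _)
  rw [div_le_div_iff₀ (by exact_mod_cast hS) (by positivity), one_mul, ← pow_add, add_comm 2]
  exact_mod_cast h

theorem one_le_lg (x : ℝ) : 1 ≤ lg x := le_max_left _ _

theorem add_lg_le_electionTime (n D : ℕ) : (D : ℝ) + lg n ≤ electionTime n D := by
  have hlg := one_le_lg n
  have hlglg := one_le_lg (lg n)
  calc (D : ℝ) + lg n ≤ D + lg n * lg (lg n) :=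
        add_le_add_right (le_mul_of_one_le_right (by positivity) hlglg) _
    _ ≤ electionTime n D :=
      le_mul_of_one_le_right (by positivity) (le_min hlglg (one_le_lg _))

theorem natLog_add_one_le_mul_lg {κ n N : ℕ} (hn : 0 < n) (hNn : N ≤ κ * n) :
    ((Nat.log 2 N + 1 : ℕ) : ℝ) ≤ (κ + 2) * lg n := by
  have hlg := one_le_lg n
  have hpow : (2 : ℝ) ^ Nat.log 2 N ≤ 2 ^ κ * n := by
    have hNn' : N ≤ 2 ^ κ * n := hNn.trans (Nat.mul_le_mul_right _ Nat.lt_two_pow_self.le)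
    rcases Nat.eq_zero_or_pos N with rfl | hN
    · simp only [Nat.log_zero_right, pow_zero]
      exact_mod_cast Nat.mul_pos (by positivity) hn
    · exact_mod_cast (Nat.pow_log_le_self 2 hN.ne').trans hNn'
  have hn' : (0 : ℝ) < n := by exact_mod_cast hn
  have hle : Real.logb 2 n ≤ lg n := le_max_right _ _
  have hlog : (Nat.log 2 N : ℝ) ≤ κ + Real.logb 2 n := by
    have := Real.logb_le_logb_of_le one_lt_two (by positivity) hpow
    rwa [Real.logb_mul (by positivity) hn'.ne', Real.logb_pow, Real.logb_pow,
      Real.logb_self_eq_one one_lt_two, mul_one, mul_one] at this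
  calc ((Nat.log 2 N + 1 : ℕ) : ℝ) = Nat.log 2 N + 1 := by push_cast; rfl
    _ ≤ (κ + lg n) + lg n := by linarith
    _ ≤ (κ * lg n + lg n) + lg n := by
      gcongr
      exact le_mul_of_one_le_right (by positivity) hlg
    _ = (κ + 2) * lg n := by ring

/-- The length of the identifiers, in units of `Nat.log 2 N + 1`. -/
def electionIdFactor (c κ : ℕ) : ℕ := (c + 2) * (κ + 1)

theorem pow_le_two_pow_idLength {κ n N : ℕ} (h : n ≤ κ * N) (c : ℕ) :
    n ^ (c + 2) ≤ 2 ^ (electionIdFactor c κ * (Nat.log 2 N + 1)) := by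
  have hn : n ≤ 2 ^ ((κ + 1) * (Nat.log 2 N + 1)) :=
    calc n ≤ κ * N := h
      _ ≤ 2 ^ κ * 2 ^ (Nat.log 2 N + 1) :=
        Nat.mul_le_mul Nat.lt_two_pow_self.le (Nat.lt_pow_succ_log_self one_lt_two N).le
      _ = 2 ^ (κ + (Nat.log 2 N + 1)) := (pow_add _ _ _).symm
      _ ≤ 2 ^ ((κ + 1) * (Nat.log 2 N + 1)) :=
        Nat.pow_le_pow_right two_pos (by nlinarith [Nat.zero_le (κ * Nat.log 2 N)])
  calc n ^ (c + 2) ≤ (2 ^ ((κ + 1) * (Nat.log 2 N + 1))) ^ (c + 2) := Nat.pow_le_pow_left hn _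
    _ = 2 ^ (electionIdFactor c κ * (Nat.log 2 N + 1)) := by
      rw [← pow_mul, electionIdFactor]
      congr 1
      ring

/-- The number of slots after which the identifier found is output: `κ * Δ` is an upper bound for
the diameter. -/
def electionSlots (c κ N Δ : ℕ) : ℕ :=
  deadline (electionIdFactor c κ * (Nat.log 2 N + 1)) (κ * Δ) + 1

theorem exists_add_slotStart_electionSlots_le (c κ : ℕ) : ∃ C : ℕ, ∀ {n D N Δ : ℕ}, 0 < n →
    N ≤ κ * n → Δ ≤ κ * D →
      ((D + slotStart (electionSlots c κ N Δ) : ℕ) : ℝ) ≤ C * (D + lg n) := by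
  refine ⟨3 * slotLength * (3 * electionIdFactor c κ * (κ + 2) + 2 * κ ^ 2 + 1) + 4,
    fun {n D N Δ} hn hN hΔ => ?_⟩
  have hlg := one_le_lg n
  have hD : (D : ℝ) ≤ D + lg n := by linarith
  have hlgD : lg n ≤ D + lg n := le_add_of_nonneg_left (Nat.cast_nonneg D)
  have hΔ' : (Δ : ℝ) ≤ κ * D := by exact_mod_cast hΔ
  have hslots : (electionSlots c κ N Δ : ℝ) ≤
      (3 * electionIdFactor c κ * (κ + 2) + 2 * κ ^ 2 + 1) * (D + lg n) :=
    calc (electionSlots c κ N Δ : ℝ)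
        = 3 * (electionIdFactor c κ * (Nat.log 2 N + 1 : ℕ)) + 2 * (κ * Δ) + 1 := by
          simp [electionSlots, deadline]
      _ ≤ 3 * (electionIdFactor c κ * ((κ + 2) * lg n)) + 2 * (κ * (κ * D)) + lg n := by
          gcongr
          exact natLog_add_one_le_mul_lg hn hN
      _ ≤ 3 * (electionIdFactor c κ * ((κ + 2) * (D + lg n))) + 2 * (κ * (κ * (D + lg n))) +
          (D + lg n) := by
          gcongr
      _ = _ := by ring
  calc ((D + slotStart (electionSlots c κ N Δ) : ℕ) : ℝ)
      = 3 * slotLength * electionSlots c κ N Δ + (D + 3) := by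
        rw [slotStart]
        push_cast
        ring
    _ ≤ 3 * slotLength * ((3 * electionIdFactor c κ * (κ + 2) + 2 * κ ^ 2 + 1) * (D + lg n)) +
        4 * (D + lg n) := by
        gcongr
        linarith
    _ = _ := by
        push_cast
        ring

/-- The leader election algorithm, in media in which `p N` is some packet. Apart from the
identifiers it is deterministic. -/
noncomputable def electionAlgorithm {m : ℕ → Medium} (p : (N : ℕ) → (m N).Packet) (c κ : ℕ) :
    DistributedAlgorithm m where
  idFactor := electionIdFactor c κ
  idFactor_pos := Nat.mul_pos (Nat.succ_pos _) (Nat.succ_pos _)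
  coins _ _ := 0
  protocol N Δ := electionProtocol (m N) (p N) _ _ (electionSlots c κ N Δ)

namespace DistributedAlgorithm

/-- The property `SolvesLeaderElection` with an arbitrary time bound `T`, a function of the number
of nodes and of the diameter. -/
def ElectsLeaderWithin {m : ℕ → Medium} (A : DistributedAlgorithm m) (c κ : ℕ)
    (T : ℕ → ℕ → ℝ) : Prop :=
  ∀ (V : Type) [Fintype V] [DecidableEq V] (G : SimpleGraph V) (W : Set V) (N Δ : ℕ),
    G.Connected → W.Nonempty →
    Fintype.card V ≤ κ * N → N ≤ κ * Fintype.card V →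
    G.diam ≤ κ * Δ → Δ ≤ κ * G.diam →
    1 - 1 / (Fintype.card V : ℝ) ^ c ≤
      uniformProb (fun ω : V → Seed (A.idFactor * (Nat.log 2 N + 1)) (A.coins N Δ) =>
        (A.protocol N Δ).ElectsLeaderBy G W ω (T (Fintype.card V) G.diam))

theorem ElectsLeaderWithin.solvesLeaderElection {m : ℕ → Medium} {A : DistributedAlgorithm m}
    {c κ C : ℕ} (h : A.ElectsLeaderWithin c κ fun n D => C * (D + lg n)) :
    A.SolvesLeaderElection c κ C := by
  intro V _ _ G W N Δ hG hW hn hN hD hΔ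
  refine (h V G W N Δ hG hW hn hN hD hΔ).trans (uniformProb_mono fun ω => ?_)
  rintro ⟨l, hunique, honly, hall⟩
  have hT : C * ((G.diam : ℝ) + lg (Fintype.card V)) ≤ C * electionTime (Fintype.card V) G.diam :=
    mul_le_mul_of_nonneg_left (add_lg_le_electionTime _ _) (Nat.cast_nonneg C)
  exact ⟨l, hunique, honly, fun t v ht => hall t v (hT.trans ht)⟩

end DistributedAlgorithm

theorem theorem2_general (c κ : ℕ) :
    ∃ C : ℕ, ∀ m : ℕ → Medium, (∀ N, Nonempty (m N).Packet) → (∀ N, (m N).DetectsNoise) →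
      ∃ A : DistributedAlgorithm m, A.ElectsLeaderWithin c κ fun n D => C * (D + lg n) := by
  obtain ⟨C, hC⟩ := exists_add_slotStart_electionSlots_le c κ
  refine ⟨C, fun m hp hm => ⟨electionAlgorithm (fun N => (hp N).some) c κ, ?_⟩⟩
  intro V _ _ G W N Δ hG hW hn hN hD hΔ
  have := hG.nonempty
  have hids : 1 - 1 / (Fintype.card V : ℝ) ^ c ≤ uniformProb
      fun ω : V → Seed (electionIdFactor c κ * (Nat.log 2 N + 1)) 0 => Function.Injective ω :=
    one_sub_one_div_pow_le_uniformProb_injective (by simpa using pow_le_two_pow_idLength hn c)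
  refine hids.trans (uniformProb_mono fun ω hω => ?_)
  have hslots :
      deadline (electionIdFactor c κ * (Nat.log 2 N + 1)) G.diam < electionSlots c κ N Δ :=
    Nat.lt_succ_of_le (Nat.add_le_add_left (Nat.mul_le_mul_left 2 hD) _)
  exact electionProtocol_electsLeaderBy (hm N) hG hW
    (fun u v huv => hω (Prod.ext huv (Subsingleton.elim _ _))) hslots (hC Fintype.card_pos hN hΔ)

theorem theorem2 (c κ : ℕ) (hκ : 1 ≤ κ) :
    ∃ C : ℕ,
      (∃ A : DistributedAlgorithm (fun _ => beepMedium), A.SolvesLeaderElection c κ C) ∧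
      (∀ k : ℕ → ℕ, ∃ A : DistributedAlgorithm (fun N => radioMedium (k N)),
        A.SolvesLeaderElection c κ C) := by
  obtain ⟨C, hC⟩ := theorem2_general c κ
  exact ⟨C, (hC _ (fun _ => ⟨()⟩) fun _ => beepMedium_detectsNoise).imp
      fun _ hA => hA.solvesLeaderElection,
    fun k => (hC _ (fun _ => ⟨fun _ => false⟩) fun N => radioMedium_detectsNoise (k N)).imp
      fun _ hA => hA.solvesLeaderElection⟩
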